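/- Let $S=\mathbb C^2/\Lambda$ be a complex torus of dimension 2, where $\Lambda\subset\mathbb C^2$ is a lattice (a discrete subgroup spanning $\mathbb C^2$ over $\mathbb R$). Let $H^{1,1}=H^{1,1}(S,\mathbb R)\subset H^2(S,\mathbb R)$ be the finite-dimensional real vector space of de Rham classes represented by closed real forms of type $(1,1)$, with its usual topology, and let $(x.y)=\int_S\alpha\wedge\beta$, for closed forms $\alpha,\beta$ representing $x,y$, be the intersection form given by the cup product. A Kähler class is the class of a Kähler form, that is, of a closed positive real $(1,1)$-form (the form associated with a Kähler metric), and the Kähler cone $\mathcal K(S)\subset H^{1,1}$ is the set of all Kähler classes. Then $\mathcal K(S)$ is non-empty and is contained in a single connected component $\mathcal C^+(S)$ of $\{x\in H^{1,1} : (x.x)>0\}$, and $$\mathcal K(S)=\mathcal C^+(S).$$ -/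

import Mathlib

open MeasureTheory
open scoped ContDiff

noncomputable section

namespace ComplexTorus

/-- The complex plane `ℂ²`, the universal cover of a two-dimensional complex torus. -/
abbrev C2 : Type := Fin 2 → ℂ

/-- The complex torus `S = ℂ² / Λ`. -/
abbrev Torus (Λ : Submodule ℤ C2) : Type := C2 ⧸ Λ

/-- The quotient map `π : ℂ² → S`. It is a local biholomorphism, and by translation it identifies
every tangent space of `S` with `ℂ²`. -/
def proj (Λ : Submodule ℤ C2) (x : C2) : Torus Λ := Submodule.Quotient.mk x

theorem proj_add (Λ : Submodule ℤ C2) (x : C2) {l : C2} (hl : l ∈ Λ) :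
    proj Λ (x + l) = proj Λ x := by
  refine (Submodule.Quotient.eq Λ).2 ?_
  simpa using hl

/-- Smooth real differential `k`-forms on `S`, as a space of functions on `S`. The tangent space at each point of `S` is `ℂ²`, so a
form assigns to each point of `S` an alternating `ℝ`-multilinear `k`-form on `ℂ²`; it is smooth
if its pullback to `ℂ²` under the local diffeomorphism `π` is smooth. -/
def smoothForms (Λ : Submodule ℤ C2) (k : ℕ) : Submodule ℝ (Torus Λ → C2 [⋀^Fin k]→L[ℝ] ℝ) where
  carrier := {α | ContDiff ℝ ∞ fun x => α (proj Λ x)}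
  add_mem' {a b} (ha : ContDiff ℝ ∞ fun x => a (proj Λ x))
      (hb : ContDiff ℝ ∞ fun x => b (proj Λ x)) := ha.add hb
  zero_mem' := (contDiff_const : ContDiff ℝ ∞ fun _ : C2 => (0 : C2 [⋀^Fin k]→L[ℝ] ℝ))
  smul_mem' c a (h : ContDiff ℝ ∞ fun x => a (proj Λ x)) := h.const_smul c

/-- The real vector space of smooth real differential `k`-forms on `S`. -/
def Form (Λ : Submodule ℤ C2) (k : ℕ) : Type := smoothForms Λ k

instance (Λ : Submodule ℤ C2) (k : ℕ) : AddCommGroup (Form Λ k) :=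
  inferInstanceAs (AddCommGroup (smoothForms Λ k))

instance (Λ : Submodule ℤ C2) (k : ℕ) : Module ℝ (Form Λ k) :=
  inferInstanceAs (Module ℝ (smoothForms Λ k))

/-- The pullback of a form on `S` to `ℂ²`. -/
def pullback {Λ : Submodule ℤ C2} {k : ℕ} (α : Form Λ k) (x : C2) : C2 [⋀^Fin k]→L[ℝ] ℝ :=
  α.1 (proj Λ x)

theorem pullback_add {Λ : Submodule ℤ C2} {k : ℕ} (a b : Form Λ k) (x : C2) :
    pullback (a + b) x = pullback a x + pullback b x := rfl

theorem pullback_smul {Λ : Submodule ℤ C2} {k : ℕ} (c : ℝ) (a : Form Λ k) (x : C2) :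
    pullback (c • a) x = c • pullback a x := rfl

theorem contDiff_pullback {Λ : Submodule ℤ C2} {k : ℕ} (α : Form Λ k) :
    ContDiff ℝ ∞ (pullback α) := α.2

theorem pullback_add_mem {Λ : Submodule ℤ C2} {k : ℕ} (α : Form Λ k) (x : C2) {l : C2}
    (hl : l ∈ Λ) : pullback α (x + l) = pullback α x := by
  simp only [pullback, proj_add Λ x hl]

theorem extDeriv_pullback_add_mem {Λ : Submodule ℤ C2} {k : ℕ} (α : Form Λ k) (x : C2) {l : C2}
    (hl : l ∈ Λ) : extDeriv (pullback α) (x + l) = extDeriv (pullback α) x := by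
  have h : (fun y => pullback α (y + l)) = pullback α :=
    funext fun y => pullback_add_mem α y hl
  have h2 : fderiv ℝ (pullback α) (x + l) = fderiv ℝ (pullback α) x := by
    rw [← fderiv_comp_add_right, h]
  simp only [extDeriv, h2]

/-- The value at a point of `S` of the exterior derivative, computed on `ℂ²`. -/
def dFun {Λ : Submodule ℤ C2} {k : ℕ} (α : Form Λ k) (p : Torus Λ) :
    C2 [⋀^Fin (k + 1)]→L[ℝ] ℝ :=
  Quotient.liftOn' p (fun x => extDeriv (pullback α) x) (by
    intro x y hxy
    have h : -x + y ∈ Λ := QuotientAddGroup.leftRel_apply.1 hxy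
    have h2 := extDeriv_pullback_add_mem α x h
    rw [add_neg_cancel_left] at h2
    exact h2.symm)

theorem dFun_proj {Λ : Submodule ℤ C2} {k : ℕ} (α : Form Λ k) (x : C2) :
    dFun α (proj Λ x) = extDeriv (pullback α) x := rfl

theorem contDiff_extDeriv {Λ : Submodule ℤ C2} {k : ℕ} (α : Form Λ k) :
    ContDiff ℝ ∞ (extDeriv (pullback α)) := by
  have h : ContDiff ℝ ∞ (fderiv ℝ (pullback α)) :=
    (contDiff_pullback α).fderiv_right (by simp)
  exact (ContinuousAlternatingMap.alternatizeUncurryFinCLM ℝ C2 ℝ (n := k)).contDiff.comp h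

/-- The exterior derivative `d` on smooth forms on `S`. -/
def d (Λ : Submodule ℤ C2) (k : ℕ) : Form Λ k →ₗ[ℝ] Form Λ (k + 1) where
  toFun α := ⟨dFun α, contDiff_extDeriv α⟩
  map_add' a b := by
    apply Subtype.ext
    funext p
    obtain ⟨x, rfl⟩ := Submodule.Quotient.mk_surjective Λ p
    exact extDeriv_add ((contDiff_pullback a).differentiable (by simp) x)
      ((contDiff_pullback b).differentiable (by simp) x)
  map_smul' c a := by
    apply Subtype.ext
    funext p
    obtain ⟨x, rfl⟩ := Submodule.Quotient.mk_surjective Λ p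
    exact extDeriv_smul c (pullback a)

theorem pullback_d {Λ : Submodule ℤ C2} {k : ℕ} (α : Form Λ k) (x : C2) :
    pullback (d Λ k α) x = extDeriv (pullback α) x := rfl

/-- Closed real `2`-forms on `S`. -/
def Closed (Λ : Submodule ℤ C2) : Submodule ℝ (Form Λ 2) := LinearMap.ker (d Λ 2)

/-- Exact real `2`-forms on `S`. -/
def Exact (Λ : Submodule ℤ C2) : Submodule ℝ (Form Λ 2) := LinearMap.range (d Λ 1)

/-- De Rham cohomology `H²(S, ℝ)`: closed `2`-forms modulo the exact ones. -/
def H2 (Λ : Submodule ℤ C2) : Type := Closed Λ ⧸ (Exact Λ).submoduleOf (Closed Λ)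

instance (Λ : Submodule ℤ C2) : AddCommGroup (H2 Λ) :=
  inferInstanceAs (AddCommGroup (Closed Λ ⧸ (Exact Λ).submoduleOf (Closed Λ)))

instance (Λ : Submodule ℤ C2) : Module ℝ (H2 Λ) :=
  inferInstanceAs (Module ℝ (Closed Λ ⧸ (Exact Λ).submoduleOf (Closed Λ)))

/-- The de Rham class of a closed `2`-form. -/
def deRhamClass (Λ : Submodule ℤ C2) : Closed Λ →ₗ[ℝ] H2 Λ :=
  ((Exact Λ).submoduleOf (Closed Λ)).mkQ

/-- The real `2`-forms of type `(1,1)`: those invariant under the complex structure,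
`α(iu, iv) = α(u, v)`. -/
def Form11 (Λ : Submodule ℤ C2) : Submodule ℝ (Form Λ 2) where
  carrier := {α | ∀ (p : Torus Λ) (u v : C2),
    α.1 p ![Complex.I • u, Complex.I • v] = α.1 p ![u, v]}
  add_mem' ha hb p u v := congrArg₂ (· + ·) (ha p u v) (hb p u v)
  zero_mem' _ _ _ := rfl
  smul_mem' c _ h p u v := congrArg (c * ·) (h p u v)

/-- `H^{1,1}(S, ℝ)`, the real `(1,1)` part of the Hodge decomposition: the classes in `H²(S, ℝ)`
represented by a closed real form of type `(1,1)`. -/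
def H11 (Λ : Submodule ℤ C2) : Submodule ℝ (H2 Λ) :=
  ((Form11 Λ).submoduleOf (Closed Λ)).map (deRhamClass Λ)

/-- `H^{1,1}(S, ℝ)` carries its canonical topology as a real vector space (on a finite-dimensional
space, the module topology is the topology given by any norm). -/
instance (Λ : Submodule ℤ C2) : TopologicalSpace (H11 Λ) := moduleTopology ℝ (H11 Λ)

/-- A Kähler form on `S`: a closed real `(1,1)`-form `α` which is positive, that is, for which
`g(u, v) = α(u, iv)` is positive definite at every point, so that `α` is the form associated with
the Hermitian metric `g`. -/
def IsKahlerForm {Λ : Submodule ℤ C2} (α : Form Λ 2) : Prop :=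
  α ∈ Closed Λ ∧ α ∈ Form11 Λ ∧
    ∀ (p : Torus Λ) (v : C2), v ≠ 0 → 0 < α.1 p ![v, Complex.I • v]

/-- The Kähler cone of `S`: the classes in `H^{1,1}(S, ℝ)` of the Kähler forms. -/
def kahlerCone (Λ : Submodule ℤ C2) : Set (H11 Λ) :=
  {x | ∃ α : Closed Λ, IsKahlerForm (α : Form Λ 2) ∧ deRhamClass Λ α = x}

/-- The wedge product of two alternating `2`-forms, evaluated on four vectors (sum over the
`(2,2)`-shuffles). -/
def wedge (a b : C2 [⋀^Fin 2]→L[ℝ] ℝ) (v : Fin 4 → C2) : ℝ :=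
  a ![v 0, v 1] * b ![v 2, v 3] - a ![v 0, v 2] * b ![v 1, v 3]
    + a ![v 0, v 3] * b ![v 1, v 2] + a ![v 1, v 2] * b ![v 0, v 3]
    - a ![v 1, v 3] * b ![v 0, v 2] + a ![v 2, v 3] * b ![v 0, v 1]

/-- The real basis `e₁, ie₁, e₂, ie₂` of `ℂ²`, positively oriented for the complex orientation;
it spans a parallelepiped of Lebesgue measure `1`. -/
def frame : Fin 4 → C2 := ![![1, 0], ![Complex.I, 0], ![0, 1], ![0, Complex.I]]

theorem wedge_comm (a b : C2 [⋀^Fin 2]→L[ℝ] ℝ) (v : Fin 4 → C2) :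
    wedge a b v = wedge b a v := by
  simp only [wedge]; ring

section Lattice

variable (Λ : Submodule ℤ C2) [DiscreteTopology Λ] [IsZLattice ℝ Λ]

/-- A fundamental parallelepiped of the lattice `Λ`. -/
def fundDom : Set C2 :=
  ZSpan.fundamentalDomain ((Module.Free.chooseBasis ℤ Λ).ofZLatticeBasis ℝ Λ)

theorem isAddFundamentalDomain_fundDom : IsAddFundamentalDomain Λ (fundDom Λ) volume :=
  ZLattice.isAddFundamentalDomain _ _

instance : VAddInvariantMeasure Λ C2 volume :=
  inferInstanceAs (VAddInvariantMeasure Λ.toAddSubgroup C2 volume)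

theorem measurableSet_fundDom : MeasurableSet (fundDom Λ) :=
  ZSpan.fundamentalDomain_measurableSet _

theorem isBounded_fundDom : Bornology.IsBounded (fundDom Λ) :=
  ZSpan.fundamentalDomain_isBounded _

theorem integrableOn_fundDom {f : C2 → ℝ} (hf : Continuous f) :
    IntegrableOn f (fundDom Λ) volume := by
  obtain ⟨R, hR⟩ := (isBounded_fundDom Λ).subset_closedBall 0
  exact (hf.continuousOn.integrableOn_compact (isCompact_closedBall 0 R)).mono_set hR

/-- The integral over the compact quotient of a directional derivative vanishes. -/
theorem integral_fderiv_eq_zero {f : C2 → ℝ} (hf : ContDiff ℝ ∞ f)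
    (hper : ∀ x, ∀ l ∈ Λ, f (x + l) = f x) (v : C2) :
    ∫ x in fundDom Λ, fderiv ℝ f x v = 0 := by
  have hdf : Continuous fun x => fderiv ℝ f x v :=
    (hf.continuous_fderiv (by simp)).clm_apply continuous_const
  obtain ⟨R, hR⟩ := (isBounded_fundDom Λ).subset_closedBall 0
  obtain ⟨C, hC⟩ := (isCompact_closedBall (0 : C2) (R + ‖v‖)).exists_bound_of_continuousOn
    hdf.continuousOn
  have key := hasDerivAt_integral_of_dominated_loc_of_deriv_le
    (μ := volume.restrict (fundDom Λ)) (x₀ := (0 : ℝ)) (s := Metric.ball 0 1)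
    (F := fun t x => f (x + t • v)) (F' := fun t x => fderiv ℝ f (x + t • v) v)
    (bound := fun _ => C) (Metric.ball_mem_nhds _ one_pos)
    (Filter.Eventually.of_forall fun t =>
      (hf.continuous.comp (g := f) (continuous_add_const (t • v))).aestronglyMeasurable)
    (integrableOn_fundDom Λ (hf.continuous.comp (continuous_add_const ((0 : ℝ) • v))))
    (hdf.comp (continuous_add_const ((0 : ℝ) • v))).aestronglyMeasurable
    (by
      filter_upwards [ae_restrict_mem (measurableSet_fundDom Λ)] with x hx t ht
      refine hC _ ?_
      have h1 : ‖x‖ ≤ R := by simpa using hR hx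
      have h2 : |t| ≤ 1 := by
        have := Metric.mem_ball.1 ht
        rw [dist_zero_right, Real.norm_eq_abs] at this
        exact this.le
      have h3 : ‖t • v‖ ≤ ‖v‖ := by
        rw [norm_smul, Real.norm_eq_abs]
        exact mul_le_of_le_one_left (norm_nonneg v) h2
      rw [mem_closedBall_zero_iff]
      exact (norm_add_le _ _).trans (add_le_add h1 h3))
    (integrableOn_fundDom Λ continuous_const)
    (Filter.Eventually.of_forall fun x t _ => by
      have h1 : HasDerivAt (fun s : ℝ => x + s • v) v t := by
        simpa using ((hasDerivAt_id t).smul_const v).const_add x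
      exact ((hf.differentiable (by simp) (x + t • v)).hasFDerivAt).comp_hasDerivAt t h1)
  have hconst : ∀ t : ℝ, ∫ x in fundDom Λ, f (x + t • v) = ∫ x in fundDom Λ, f x := by
    intro t
    have hD := isAddFundamentalDomain_fundDom Λ
    have hmp : MeasurePreserving (fun x : C2 => x + t • v) volume volume :=
      measurePreserving_add_right volume (t • v)
    have hD2 := hD.image_of_equiv (ν := volume) (Equiv.addRight (t • v))
      (by
        have := (measurePreserving_add_right (volume : Measure C2) (-(t • v))).quasiMeasurePreserving
        simpa [Equiv.addRight] using this)
      (Equiv.refl Λ) (by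
        intro g x
        simp [Submodule.vadd_def, add_assoc])
    have hinv : ∀ (g : Λ) (x : C2), f (g +ᵥ x) = f x := by
      intro g x
      have h1 := hper x g g.2
      rw [add_comm] at h1
      exact h1
    rw [hD.setIntegral_eq hD2 hinv]
    exact (hmp.setIntegral_image_emb (measurableEmbedding_addRight (t • v)) f (fundDom Λ)).symm
  have h0 : HasDerivAt (fun t : ℝ => ∫ x in fundDom Λ, f (x + t • v)) 0 0 := by
    simp only [hconst]
    exact hasDerivAt_const _ _
  simpa using key.2.unique h0

theorem continuous_pullback_apply {Λ : Submodule ℤ C2} {k : ℕ} (α : Form Λ k) (v : Fin k → C2) :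
    ContDiff ℝ ∞ fun x => pullback α x v :=
  (ContinuousAlternatingMap.apply ℝ C2 ℝ v).contDiff.comp (contDiff_pullback α)

theorem continuous_wedge {Λ : Submodule ℤ C2} (a b : Form Λ 2) (v : Fin 4 → C2) :
    Continuous fun x => wedge (pullback a x) (pullback b x) v := by
  have h : ∀ (α : Form Λ 2) (w : Fin 2 → C2), Continuous fun x => pullback α x w :=
    fun α w => (continuous_pullback_apply α w).continuous
  unfold wedge
  fun_prop (disch := exact h _ _)

/-- The pairing `∫_S a ∧ b` of `2`-forms on `S`, where `S` has the orientation given by its complex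
structure. -/
def formPairing : Form Λ 2 →ₗ[ℝ] Form Λ 2 →ₗ[ℝ] ℝ :=
  LinearMap.mk₂ ℝ
    (fun a b => ∫ x in fundDom Λ, wedge (pullback a x) (pullback b x) frame)
    (by
      intro a a' b
      rw [← integral_add (integrableOn_fundDom Λ (continuous_wedge a b frame))
        (integrableOn_fundDom Λ (continuous_wedge a' b frame))]
      congr 1; funext x
      simp [wedge, pullback_add]; ring)
    (by
      intro c a b
      rw [smul_eq_mul, ← integral_const_mul]
      congr 1; funext x
      simp [wedge, pullback_smul]; ring)
    (by
      intro a b b'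
      rw [← integral_add (integrableOn_fundDom Λ (continuous_wedge a b frame))
        (integrableOn_fundDom Λ (continuous_wedge a b' frame))]
      congr 1; funext x
      simp [wedge, pullback_add]; ring)
    (by
      intro c a b
      rw [smul_eq_mul, ← integral_const_mul]
      congr 1; funext x
      simp [wedge, pullback_smul]; ring)

theorem formPairing_apply (a b : Form Λ 2) :
    formPairing Λ a b = ∫ x in fundDom Λ, wedge (pullback a x) (pullback b x) frame := rfl

theorem formPairing_comm (a b : Form Λ 2) : formPairing Λ a b = formPairing Λ b a := by
  simp only [formPairing_apply, wedge_comm]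

theorem extDeriv_one_apply {Λ : Submodule ℤ C2} (η : Form Λ 1) (x u v : C2) :
    extDeriv (pullback η) x ![u, v] =
      fderiv ℝ (fun y => pullback η y ![v]) x u - fderiv ℝ (fun y => pullback η y ![u]) x v := by
  rw [extDeriv_apply ((contDiff_pullback η).differentiable (by simp) x), Fin.sum_univ_two]
  have h0 : (0 : Fin 2).removeNth ![u, v] = ![v] := by ext i; fin_cases i; rfl
  have h1 : (1 : Fin 2).removeNth ![u, v] = ![u] := by ext i; fin_cases i; rfl
  rw [h0, h1]
  simp [sub_eq_add_neg]

theorem extDeriv_two_apply {Λ : Submodule ℤ C2} (b : Form Λ 2) (x u v w : C2) :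
    extDeriv (pullback b) x ![u, v, w] =
      fderiv ℝ (fun y => pullback b y ![v, w]) x u - fderiv ℝ (fun y => pullback b y ![u, w]) x v
        + fderiv ℝ (fun y => pullback b y ![u, v]) x w := by
  rw [extDeriv_apply ((contDiff_pullback b).differentiable (by simp) x), Fin.sum_univ_three]
  have h0 : (0 : Fin 3).removeNth ![u, v, w] = ![v, w] := by ext i; fin_cases i <;> rfl
  have h1 : (1 : Fin 3).removeNth ![u, v, w] = ![u, w] := by ext i; fin_cases i <;> rfl
  have h2 : (2 : Fin 3).removeNth ![u, v, w] = ![u, v] := by ext i; fin_cases i <;> rfl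
  rw [h0, h1, h2]
  simp [sub_eq_add_neg]

theorem integral_mul_add_mul {Λ : Submodule ℤ C2} [DiscreteTopology Λ] [IsZLattice ℝ Λ]
    (η : Form Λ 1) (b : Form Λ 2) (u v w z : C2) :
    ∫ x in fundDom Λ, (fderiv ℝ (fun y => pullback η y ![v]) x u * pullback b x ![w, z]
      + pullback η x ![v] * fderiv ℝ (fun y => pullback b y ![w, z]) x u) = 0 := by
  have hη := continuous_pullback_apply η ![v]
  have hb := continuous_pullback_apply b ![w, z]
  rw [← integral_fderiv_eq_zero Λ (hη.mul hb) (fun x l hl => by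
    simp only [pullback_add_mem _ x hl]) u]
  congr 1; funext x
  rw [fderiv_fun_mul (hη.differentiable (by simp) x) (hb.differentiable (by simp) x)]
  simp
  ring

/-- Stokes' theorem for `∫_S dη ∧ b` with `b` closed. -/
theorem formPairing_d (η : Form Λ 1) (b : Form Λ 2) (hb : b ∈ Closed Λ) :
    formPairing Λ (d Λ 1 η) b = 0 := by
  have hcl : ∀ x u v w : C2, extDeriv (pullback b) x ![u, v, w] = 0 := by
    intro x u v w
    have h : d Λ 2 b = 0 := hb
    rw [← pullback_d, h]
    rfl
  have hint : ∀ u v w z : C2, Integrable (fun x =>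
      fderiv ℝ (fun y => pullback η y ![v]) x u * pullback b x ![w, z]
      + pullback η x ![v] * fderiv ℝ (fun y => pullback b y ![w, z]) x u)
      (volume.restrict (fundDom Λ)) := by
    intro u v w z
    have hη := continuous_pullback_apply η ![v]
    have hb := continuous_pullback_apply b ![w, z]
    refine integrableOn_fundDom Λ ?_
    exact (((hη.continuous_fderiv (by simp)).clm_apply continuous_const).mul hb.continuous).add
      (hη.continuous.mul ((hb.continuous_fderiv (by simp)).clm_apply continuous_const))
  set G : C2 → C2 → C2 → C2 → C2 → ℝ := fun u v w z x =>
    fderiv ℝ (fun y => pullback η y ![v]) x u * pullback b x ![w, z]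
      + pullback η x ![v] * fderiv ℝ (fun y => pullback b y ![w, z]) x u with hG
  have hG0 : ∀ u v w z, ∫ x in fundDom Λ, G u v w z x = 0 := integral_mul_add_mul η b
  have hGi : ∀ u v w z, Integrable (G u v w z) (volume.restrict (fundDom Λ)) := hint
  rw [formPairing_apply]
  obtain ⟨e0, he0⟩ : ∃ e, e = frame 0 := ⟨_, rfl⟩
  obtain ⟨e1, he1⟩ : ∃ e, e = frame 1 := ⟨_, rfl⟩
  obtain ⟨e2, he2⟩ : ∃ e, e = frame 2 := ⟨_, rfl⟩
  obtain ⟨e3, he3⟩ : ∃ e, e = frame 3 := ⟨_, rfl⟩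
  have hsum : ∀ x, wedge (pullback (d Λ 1 η) x) (pullback b x) frame =
      ((G e0 e1 e2 e3 x - G e1 e0 e2 e3 x) - (G e0 e2 e1 e3 x - G e2 e0 e1 e3 x))
      + ((G e0 e3 e1 e2 x - G e3 e0 e1 e2 x) + (G e1 e2 e0 e3 x - G e2 e1 e0 e3 x))
      - ((G e1 e3 e0 e2 x - G e3 e1 e0 e2 x) - (G e2 e3 e0 e1 x - G e3 e2 e0 e1 x)) := by
    intro x
    have k0 := hcl x e1 e2 e3
    have k1 := hcl x e0 e2 e3
    have k2 := hcl x e0 e1 e3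
    have k3 := hcl x e0 e1 e2
    rw [extDeriv_two_apply] at k0 k1 k2 k3
    simp only [wedge, ← he0, ← he1, ← he2, ← he3, pullback_d, extDeriv_one_apply, hG]
    linear_combination (pullback η x ![e0]) * k0 - (pullback η x ![e1]) * k1
      + (pullback η x ![e2]) * k2 - (pullback η x ![e3]) * k3
  simp only [hsum]
  have hi2 : ∀ u v w z u' v' w' z', Integrable (fun x => G u v w z x - G u' v' w' z' x)
      (volume.restrict (fundDom Λ)) := fun u v w z u' v' w' z' =>
    (hGi u v w z).sub (hGi u' v' w' z')
  have h2 : ∀ u v w z u' v' w' z', ∫ x in fundDom Λ, (G u v w z x - G u' v' w' z' x) = 0 := by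
    intro u v w z u' v' w' z'
    rw [integral_sub (hGi _ _ _ _) (hGi _ _ _ _), hG0, hG0, sub_zero]
  have h4 : ∀ {f g : C2 → ℝ}, Integrable f (volume.restrict (fundDom Λ)) →
      Integrable g (volume.restrict (fundDom Λ)) → ∫ x in fundDom Λ, f x = 0 →
      ∫ x in fundDom Λ, g x = 0 → ∫ x in fundDom Λ, (f x - g x) = 0 := by
    intro f g hf hg h h'
    rw [integral_sub hf hg, h, h', sub_zero]
  have h5 : ∀ {f g : C2 → ℝ}, Integrable f (volume.restrict (fundDom Λ)) →
      Integrable g (volume.restrict (fundDom Λ)) → ∫ x in fundDom Λ, f x = 0 →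
      ∫ x in fundDom Λ, g x = 0 → ∫ x in fundDom Λ, (f x + g x) = 0 := by
    intro f g hf hg h h'
    rw [integral_add hf hg, h, h', add_zero]
  have hI := fun u v w z u' v' w' z' => hi2 u v w z u' v' w' z'
  refine h4 (((hI _ _ _ _ _ _ _ _).sub (hI _ _ _ _ _ _ _ _)).add
      ((hI _ _ _ _ _ _ _ _).add (hI _ _ _ _ _ _ _ _)))
    ((hI _ _ _ _ _ _ _ _).sub (hI _ _ _ _ _ _ _ _))
    (h5 ((hI _ _ _ _ _ _ _ _).sub (hI _ _ _ _ _ _ _ _))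
      ((hI _ _ _ _ _ _ _ _).add (hI _ _ _ _ _ _ _ _))
      (h4 (hI _ _ _ _ _ _ _ _) (hI _ _ _ _ _ _ _ _) (h2 _ _ _ _ _ _ _ _) (h2 _ _ _ _ _ _ _ _))
      (h5 (hI _ _ _ _ _ _ _ _) (hI _ _ _ _ _ _ _ _) (h2 _ _ _ _ _ _ _ _) (h2 _ _ _ _ _ _ _ _)))
    (h4 (hI _ _ _ _ _ _ _ _) (hI _ _ _ _ _ _ _ _) (h2 _ _ _ _ _ _ _ _) (h2 _ _ _ _ _ _ _ _))

/-- The intersection form `(x.y) = ∫_S a ∧ b` on `H²(S, ℝ)`, where the closed forms `a` and `b`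
represent `x` and `y`; it is the cup product. -/
def intersectionForm : H2 Λ →ₗ[ℝ] H2 Λ →ₗ[ℝ] ℝ :=
  ((Exact Λ).submoduleOf (Closed Λ)).liftQ
    { toFun := fun a => ((Exact Λ).submoduleOf (Closed Λ)).liftQ
        ((formPairing Λ (a : Form Λ 2)).comp (Closed Λ).subtype) (by
          rintro b ⟨η, hη⟩
          change formPairing Λ (a : Form Λ 2) (b : Form Λ 2) = 0
          rw [formPairing_comm]
          have h : d Λ 1 η = (b : Form Λ 2) := hη
          rw [← h]
          exact formPairing_d Λ η _ a.2)
      map_add' := fun a a' => by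
        refine Submodule.linearMap_qext _ (LinearMap.ext fun b => ?_)
        change formPairing Λ ((a : Form Λ 2) + (a' : Form Λ 2)) (b : Form Λ 2) =
          formPairing Λ (a : Form Λ 2) (b : Form Λ 2) + formPairing Λ (a' : Form Λ 2) (b : Form Λ 2)
        rw [map_add, LinearMap.add_apply]
      map_smul' := fun c a => by
        refine Submodule.linearMap_qext _ (LinearMap.ext fun b => ?_)
        change formPairing Λ (c • (a : Form Λ 2)) (b : Form Λ 2) =
          c • formPairing Λ (a : Form Λ 2) (b : Form Λ 2)
        rw [map_smul, LinearMap.smul_apply] }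
    (by
      rintro a ⟨η, hη⟩
      refine Submodule.linearMap_qext _ (LinearMap.ext fun b => ?_)
      change formPairing Λ (a : Form Λ 2) (b : Form Λ 2) = 0
      have h : d Λ 1 η = (a : Form Λ 2) := hη
      rw [← h]
      exact formPairing_d Λ η _ b.2)

theorem intersectionForm_deRhamClass (a b : Closed Λ) :
    intersectionForm Λ (deRhamClass Λ a) (deRhamClass Λ b) =
      ∫ x in fundDom Λ, wedge (pullback (a : Form Λ 2) x) (pullback (b : Form Λ 2) x) frame := rfl

/-- The set `{x ∈ H^{1,1}(S, ℝ) | (x.x) > 0}`. -/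
def positiveSet : Set (H11 Λ) := {x | 0 < intersectionForm Λ x x}

end Lattice

end ComplexTorus

end

/-!
The cohomology of a torus is carried by its translation-invariant forms, so the theorem reduces to
the linear algebra of Hermitian `2 × 2` matrices.

Translation by `a` is homotopic to the identity, and on a closed form `α` the homotopy operator
`∫₀¹ ι_a α(x + t a) dt` is a primitive of the difference between the translate of `α` and `α`
(`extDeriv_translationHomotopy`). Averaging these primitives over all `a` in a fundamental domain
shows that `α` is cohomologous to its average (`deRhamClass_constForm_average`). This needs neither
Fourier series nor harmonic forms, only differentiation under the integral sign
(`contDiff_integral_of_contDiff`, `extDeriv_integral_of_contDiff`). The average of a form of type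
`(1,1)` is of type `(1,1)`, and the average of a positive form is positive. Hence every class in
`H^{1,1}` is represented by a constant form of type `(1,1)`, and it is a Kähler class exactly when
a positive constant form represents it (`mem_kahlerCone_iff`).

A constant form `w` of type `(1,1)` is a Hermitian matrix: `w ∧ w` is twice its determinant, and
the product with the standard Kähler form is its trace. So Kähler classes have positive square and
positive degree with respect to the standard Kähler class; conversely a class with both is Kähler
by Sylvester's criterion (`IsType11.isPositive`). The degree is a continuous linear function
without zeros on the classes of positive square (`degree_ne_zero`), so it is positive on the whole
connected component of a Kähler class, which gives one inclusion. The other holds because the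
Kähler cone is convex (`convex_kahlerCone`), hence connected.
-/

/-! ### Differentiation of integrals depending on a parameter -/

section ParametricIntegral

universe u v

variable {E F : Type u} [NormedAddCommGroup E] [NormedSpace ℝ E] [ProperSpace E]
  [NormedAddCommGroup F] [NormedSpace ℝ F] {P : Type v} [NormedAddCommGroup P]
  [MeasurableSpace P] [OpensMeasurableSpace P] [SecondCountableTopology P]
  {μ : Measure P} [IsFiniteMeasure μ] {K : Set P}

theorem integrable_of_continuous_of_ae_mem_compact {G : Type*} [NormedAddCommGroup G]
    (hK : IsCompact K) (hμ : ∀ᵐ p ∂μ, p ∈ K) {f : P → G} (hf : Continuous f) :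
    Integrable f μ := by
  obtain ⟨C, hC⟩ := hK.exists_bound_of_continuousOn hf.continuousOn
  exact Integrable.of_bound hf.aestronglyMeasurable C (hμ.mono hC)

variable [NormedSpace ℝ P]

theorem hasFDerivAt_integral_of_contDiff (hK : IsCompact K) (hμ : ∀ᵐ p ∂μ, p ∈ K)
    {f : E × P → F} (hf : ContDiff ℝ 1 f) (x : E) :
    HasFDerivAt (fun y => ∫ p, f (y, p) ∂μ)
      (∫ p, (fderiv ℝ f (x, p)).comp (ContinuousLinearMap.inl ℝ E P) ∂μ) x := by
  have hd : Continuous fun z : E × P =>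
      (fderiv ℝ f z).comp (ContinuousLinearMap.inl ℝ E P) :=
    (hf.continuous_fderiv one_ne_zero).clm_comp continuous_const
  obtain ⟨C, hC⟩ := ((isCompact_closedBall x 1).prod hK).exists_bound_of_continuousOn
    hd.continuousOn
  refine hasFDerivAt_integral_of_dominated_of_fderiv_le
    (F' := fun y p => (fderiv ℝ f (y, p)).comp (ContinuousLinearMap.inl ℝ E P))
    (bound := fun _ => C) (Metric.closedBall_mem_nhds x one_pos)
    (Filter.Eventually.of_forall fun y =>
      (hf.continuous.comp (by fun_prop : Continuous fun p : P => (y, p))).aestronglyMeasurable)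
    (integrable_of_continuous_of_ae_mem_compact hK hμ
      (hf.continuous.comp (by fun_prop : Continuous fun p : P => (x, p))))
    (hd.comp (by fun_prop : Continuous fun p : P => (x, p))).aestronglyMeasurable
    (hμ.mono fun p hp y hy => hC (y, p) ⟨hy, hp⟩) (integrable_const C)
    (Filter.Eventually.of_forall fun p y _ => ?_)
  exact ((hf.differentiable one_ne_zero (y, p)).hasFDerivAt).comp y
    (hasFDerivAt_prodMk_left y p)

/-- Integrals over a compactly supported finite measure depend smoothly on the parameter if the
integrand is jointly smooth. -/
theorem contDiff_integral_of_contDiff (hK : IsCompact K) (hμ : ∀ᵐ p ∂μ, p ∈ K)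
    {f : E × P → F} (hf : ContDiff ℝ ∞ f) : ContDiff ℝ ∞ fun x => ∫ p, f (x, p) ∂μ := by
  rw [contDiff_infty]
  intro n
  -- The values of the derivative lie in `E →L[ℝ] F`, so the target varies in the induction.
  induction n generalizing F with
  | zero =>
    refine contDiff_zero.2 (continuous_iff_continuousAt.2 fun x => ?_)
    exact (hasFDerivAt_integral_of_contDiff hK hμ (hf.of_le (by simp)) x).continuousAt
  | succ n ih =>
    have h := hasFDerivAt_integral_of_contDiff hK hμ (hf.of_le (m := 1) (by simp))
    push_cast
    rw [contDiff_succ_iff_fderiv]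
    refine ⟨fun x => (h x).differentiableAt, by simp, ?_⟩
    rw [funext fun x => (h x).fderiv]
    exact ih (f := fun z => (fderiv ℝ f z).comp (ContinuousLinearMap.inl ℝ E P))
      ((hf.fderiv_right (by simp)).clm_comp contDiff_const)

theorem clm_fderiv_integral_of_contDiff {H : Type*} [NormedAddCommGroup H] [NormedSpace ℝ H]
    [CompleteSpace F] [CompleteSpace H] (hK : IsCompact K) (hμ : ∀ᵐ p ∂μ, p ∈ K)
    {f : E × P → F} (hf : ContDiff ℝ 1 f) (T : (E →L[ℝ] F) →L[ℝ] H) (x : E) :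
    T (fderiv ℝ (fun y => ∫ p, f (y, p) ∂μ) x) = ∫ p, T (fderiv ℝ (fun y => f (y, p)) x) ∂μ := by
  have hd : ∀ p, fderiv ℝ (fun y => f (y, p)) x
      = (fderiv ℝ f (x, p)).comp (ContinuousLinearMap.inl ℝ E P) := fun p =>
    (((hf.differentiable one_ne_zero (x, p)).hasFDerivAt).comp x
      (hasFDerivAt_prodMk_left x p)).fderiv
  have hi : Integrable (fun p => (fderiv ℝ f (x, p)).comp (ContinuousLinearMap.inl ℝ E P)) μ :=
    integrable_of_continuous_of_ae_mem_compact hK hμ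
      (((hf.continuous_fderiv one_ne_zero).comp
        (by fun_prop : Continuous fun p : P => (x, p))).clm_comp continuous_const)
  simp only [hd, (hasFDerivAt_integral_of_contDiff hK hμ hf x).fderiv]
  exact (T.integral_comp_comm hi).symm

/-- The exterior derivative commutes with integration over a parameter. -/
theorem extDeriv_integral_of_contDiff {k : ℕ} (hK : IsCompact K) (hμ : ∀ᵐ p ∂μ, p ∈ K)
    {f : E × P → E [⋀^Fin k]→L[ℝ] ℝ} (hf : ContDiff ℝ 1 f) (x : E) :
    extDeriv (fun y => ∫ p, f (y, p) ∂μ) x = ∫ p, extDeriv (fun y => f (y, p)) x ∂μ :=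
  clm_fderiv_integral_of_contDiff hK hμ hf
    (ContinuousAlternatingMap.alternatizeUncurryFinCLM ℝ E ℝ (n := k)) x

end ParametricIntegral

noncomputable section

namespace ComplexTorus

/-! ### Translations act trivially on cohomology -/

/-- The integrand of the homotopy operator of a translation: at the pair `(x, a)` and the time `t`,
the contraction with `a` of the value of `α` at `x + t a`. -/
def contractAlong {Λ : Submodule ℤ C2} (α : Form Λ 2) (z : (C2 × C2) × ℝ) :
    C2 [⋀^Fin 1]→L[ℝ] ℝ :=
  (pullback α (z.1.1 + z.2 • z.1.2)).curryLeft z.1.2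

theorem contDiff_contractAlong {Λ : Submodule ℤ C2} (α : Form Λ 2) :
    ContDiff ℝ ∞ (contractAlong α) := by
  have h1 : ContDiff ℝ ∞ fun z : (C2 × C2) × ℝ => pullback α (z.1.1 + z.2 • z.1.2) :=
    (contDiff_pullback α).comp (by fun_prop)
  have h2 : IsBoundedLinearMap ℝ fun w : C2 [⋀^Fin 2]→L[ℝ] ℝ => w.curryLeft :=
    IsLinearMap.with_bound ⟨ContinuousAlternatingMap.curryLeft_add,
      ContinuousAlternatingMap.curryLeft_smul⟩ 1 fun w => by
        rw [one_mul]; exact (ContinuousAlternatingMap.norm_curryLeft w).le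
  have h3 : ContDiff ℝ ∞ fun z : (C2 × C2) × ℝ => z.1.2 := by fun_prop
  exact (h2.contDiff.comp h1).clm_apply h3

/-- For closed `α`, Cartan's formula: the exterior derivative of a contraction with a constant
vector field is the Lie derivative. -/
theorem extDeriv_contractAlong {Λ : Submodule ℤ C2} (α : Form Λ 2) (hα : α ∈ Closed Λ)
    (a : C2) (t : ℝ) (x : C2) :
    extDeriv (fun y => contractAlong α ((y, a), t)) x = fderiv ℝ (pullback α) (x + t • a) a := by
  ext w
  obtain ⟨u, v, rfl⟩ : ∃ u v, w = ![u, v] := ⟨w 0, w 1, by ext i; fin_cases i <;> rfl⟩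
  have hs : ContDiff ℝ ∞ fun y => contractAlong α ((y, a), t) :=
    (contDiff_contractAlong α).comp (by fun_prop)
  have hd : ∀ v u : C2, fderiv ℝ (fun y => contractAlong α ((y, a), t) ![v]) x u =
      fderiv ℝ (fun y => pullback α y ![a, v]) (x + t • a) u := fun v u => by
    rw [← fderiv_comp_add_right]
    rfl
  have hd2 : fderiv ℝ (fun y => pullback α y ![u, v]) (x + t • a) a =
      fderiv ℝ (pullback α) (x + t • a) a ![u, v] := by
    have h1 := ((ContinuousAlternatingMap.apply ℝ C2 ℝ ![u, v]).hasFDerivAt.comp (x + t • a)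
      ((contDiff_pullback α).differentiable (by simp) (x + t • a)).hasFDerivAt).fderiv
    exact congrArg (fun T => T a) h1
  have hcl : extDeriv (pullback α) (x + t • a) = 0 := by
    have h : d Λ 2 α = 0 := hα
    rw [← pullback_d, h]
    rfl
  have h3 := extDeriv_two_apply α (x + t • a) a u v
  rw [hcl] at h3
  rw [extDeriv_apply (hs.differentiable (by simp) x), Fin.sum_univ_two]
  have h0 : (0 : Fin 2).removeNth ![u, v] = ![v] := by ext i; fin_cases i; rfl
  have h1 : (1 : Fin 2).removeNth ![u, v] = ![u] := by ext i; fin_cases i; rfl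
  rw [h0, h1]
  simp only [Fin.val_zero, Fin.val_one, pow_zero, pow_one, one_smul, neg_smul, Matrix.cons_val_zero,
    Matrix.cons_val_one, ← hd2]
  rw [hd, hd]
  have h4 : (0 : C2 [⋀^Fin 3]→L[ℝ] ℝ) ![a, u, v] = 0 := rfl
  linarith

/-- The homotopy operator of the translation by `a`, applied to `α` and evaluated at `x`, for
`z = (x, a)`. -/
def translationHomotopy {Λ : Submodule ℤ C2} (α : Form Λ 2) (z : C2 × C2) :
    C2 [⋀^Fin 1]→L[ℝ] ℝ :=
  ∫ t in Set.Icc (0 : ℝ) 1, contractAlong α (z, t)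

theorem contDiff_translationHomotopy {Λ : Submodule ℤ C2} (α : Form Λ 2) :
    ContDiff ℝ ∞ (translationHomotopy α) :=
  contDiff_integral_of_contDiff isCompact_Icc (ae_restrict_mem measurableSet_Icc)
    (contDiff_contractAlong α)

theorem translationHomotopy_add_mem {Λ : Submodule ℤ C2} (α : Form Λ 2) (x a : C2) {l : C2}
    (hl : l ∈ Λ) : translationHomotopy α (x + l, a) = translationHomotopy α (x, a) := by
  simp only [translationHomotopy, contractAlong, add_right_comm x l, pullback_add_mem α _ hl]

theorem extDeriv_translationHomotopy {Λ : Submodule ℤ C2} (α : Form Λ 2) (hα : α ∈ Closed Λ)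
    (a x : C2) :
    extDeriv (fun y => translationHomotopy α (y, a)) x = pullback α (x + a) - pullback α x := by
  have hs : ContDiff ℝ 1 fun z : C2 × ℝ => contractAlong α ((z.1, a), z.2) :=
    ((contDiff_contractAlong α).of_le (by simp)).comp (by fun_prop)
  have h1 := extDeriv_integral_of_contDiff (μ := volume.restrict (Set.Icc (0 : ℝ) 1))
    isCompact_Icc (ae_restrict_mem measurableSet_Icc) hs x
  refine h1.trans ?_
  simp only [extDeriv_contractAlong α hα]
  rw [integral_Icc_eq_integral_Ioc, ← intervalIntegral.integral_of_le zero_le_one]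
  have hc : Continuous fun t : ℝ => fderiv ℝ (pullback α) (x + t • a) a :=
    (((contDiff_pullback α).continuous_fderiv (by simp)).comp
      (by fun_prop : Continuous fun t : ℝ => x + t • a)).clm_apply continuous_const
  have h2 := intervalIntegral.integral_eq_sub_of_hasDerivAt (a := 0) (b := 1)
    (f := fun t : ℝ => pullback α (x + t • a)) (fun t _ => by
      have h1 : HasDerivAt (fun s : ℝ => x + s • a) a t := by
        simpa using ((hasDerivAt_id t).smul_const a).const_add x
      exact (((contDiff_pullback α).differentiable (by simp)
        (x + t • a)).hasFDerivAt).comp_hasDerivAt t h1) (hc.intervalIntegrable 0 1)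
  simpa using h2

/-! ### The average of a form -/

section Average

variable (Λ : Submodule ℤ C2)

/-- The translation-invariant form on `S` with the given value. -/
def constForm {k : ℕ} (w : C2 [⋀^Fin k]→L[ℝ] ℝ) : Form Λ k := 
  ⟨fun _ => w, (contDiff_const : ContDiff ℝ ∞ fun _ : C2 => w)⟩

theorem pullback_constForm {k : ℕ} (w : C2 [⋀^Fin k]→L[ℝ] ℝ) (x : C2) :
    pullback (constForm Λ w) x = w := rfl

theorem constForm_mem_closed (w : C2 [⋀^Fin 2]→L[ℝ] ℝ) : constForm Λ w ∈ Closed Λ := by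
  refine LinearMap.mem_ker.2 (Subtype.ext (funext fun p => ?_))
  obtain ⟨x, rfl⟩ := Submodule.Quotient.mk_surjective Λ p
  exact (congrArg (ContinuousAlternatingMap.alternatizeUncurryFinCLM ℝ C2 ℝ (n := 2))
    (congrFun (fderiv_fun_const w) x)).trans (map_zero _)

variable [DiscreteTopology Λ] [IsZLattice ℝ Λ]

theorem volume_real_fundDom_pos : 0 < volume.real (fundDom Λ) := by
  have h0 := (isAddFundamentalDomain_fundDom Λ).measure_ne_zero (NeZero.ne _)
  exact ENNReal.toReal_pos h0 (isBounded_fundDom Λ).measure_lt_top.ne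

instance : IsFiniteMeasure ((volume : Measure C2).restrict (fundDom Λ)) :=
  isFiniteMeasure_restrict.2 (isBounded_fundDom Λ).measure_lt_top.ne

theorem isCompact_closure_fundDom : IsCompact (closure (fundDom Λ)) :=
  (isBounded_fundDom Λ).isCompact_closure

theorem ae_mem_closure_fundDom :
    ∀ᵐ a ∂(volume : Measure C2).restrict (fundDom Λ), a ∈ closure (fundDom Λ) :=
  (ae_restrict_mem (measurableSet_fundDom Λ)).mono fun _ h => subset_closure h

theorem integrableOn_fundDom_of_continuous {G : Type*} [NormedAddCommGroup G] {f : C2 → G}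
    (hf : Continuous f) : IntegrableOn f (fundDom Λ) volume :=
  integrable_of_continuous_of_ae_mem_compact (isCompact_closure_fundDom Λ)
    (ae_mem_closure_fundDom Λ) hf

theorem integral_fundDom_add_left {G : Type*} [NormedAddCommGroup G] [NormedSpace ℝ G] {f : C2 → G}
    (hper : ∀ x, ∀ l ∈ Λ, f (x + l) = f x) (v : C2) :
    ∫ x in fundDom Λ, f (v + x) = ∫ x in fundDom Λ, f x := by
  have hD := isAddFundamentalDomain_fundDom Λ
  have hmp : MeasurePreserving (fun x : C2 => x + v) volume volume :=
    measurePreserving_add_right volume v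
  have hD2 := hD.image_of_equiv (ν := volume) (Equiv.addRight v)
    (by
      have := (measurePreserving_add_right (volume : Measure C2) (-v)).quasiMeasurePreserving
      simpa [Equiv.addRight] using this)
    (Equiv.refl Λ) (by
      intro g x
      simp [Submodule.vadd_def, add_assoc])
  have hinv : ∀ (g : Λ) (x : C2), f (g +ᵥ x) = f x := by
    intro g x
    have h1 := hper x g g.2
    rw [add_comm] at h1
    exact h1
  rw [hD.setIntegral_eq hD2 hinv]
  simp only [add_comm v]
  exact (hmp.setIntegral_image_emb (measurableEmbedding_addRight v) f (fundDom Λ)).symm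

variable {Λ}

/-- The average of a `2`-form over `S`, an alternating form on `ℂ²`. -/
def average (α : Form Λ 2) : C2 [⋀^Fin 2]→L[ℝ] ℝ := ⨍ x in fundDom Λ, pullback α x

theorem average_apply (α : Form Λ 2) (v : Fin 2 → C2) :
    average α v = (volume.real (fundDom Λ))⁻¹ * ∫ x in fundDom Λ, pullback α x v := by
  rw [average, setAverage_eq, ContinuousAlternatingMap.smul_apply, smul_eq_mul]
  congr 1
  exact ((ContinuousAlternatingMap.apply ℝ C2 ℝ v).integral_comp_comm
    (integrableOn_fundDom_of_continuous Λ (contDiff_pullback α).continuous)).symm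

/-- The integral, over `a` in a fundamental domain, of the homotopy operators of the translations by
`a` applied to `α`: divided by the volume of `S`, a primitive of the difference between the average
of a closed form `α` and `α`. -/
def integralPrimitive (α : Form Λ 2) : Form Λ 1 :=
  ⟨fun p => Quotient.liftOn' p (fun x => ∫ a in fundDom Λ, translationHomotopy α (x, a)) (by
      intro x y hxy
      have h : -x + y ∈ Λ := QuotientAddGroup.leftRel_apply.1 hxy
      have h2 := fun a => translationHomotopy_add_mem α x a h
      rw [add_neg_cancel_left] at h2
      simp only [h2]),
    contDiff_integral_of_contDiff (isCompact_closure_fundDom Λ) (ae_mem_closure_fundDom Λ)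
      (contDiff_translationHomotopy α)⟩

theorem d_integralPrimitive (α : Form Λ 2) (hα : α ∈ Closed Λ) :
    d Λ 1 ((volume.real (fundDom Λ))⁻¹ • integralPrimitive α) = constForm Λ (average α) - α := by
  rw [map_smul]
  apply Subtype.ext
  funext p
  obtain ⟨x, rfl⟩ := Submodule.Quotient.mk_surjective Λ p
  change (volume.real (fundDom Λ))⁻¹ •
      extDeriv (fun y => ∫ a in fundDom Λ, translationHomotopy α (y, a)) x
    = average α - pullback α x
  rw [extDeriv_integral_of_contDiff (isCompact_closure_fundDom Λ) (ae_mem_closure_fundDom Λ)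
    ((contDiff_translationHomotopy α).of_le (by simp))]
  simp only [extDeriv_translationHomotopy α hα]
  have hc := (contDiff_pullback α).continuous
  have h1 : Integrable (fun a => pullback α (x + a)) (volume.restrict (fundDom Λ)) :=
    integrableOn_fundDom_of_continuous Λ (hc.comp (continuous_const_add x))
  rw [integral_sub h1 (integrable_const _),
    integral_fundDom_add_left Λ (fun y l hl => pullback_add_mem α y hl) x, smul_sub,
    integral_const, smul_smul, average, setAverage_eq, measureReal_restrict_apply_univ,
    inv_mul_cancel₀ (volume_real_fundDom_pos Λ).ne', one_smul]

/-- Every closed form is cohomologous to its average. -/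
theorem deRhamClass_constForm_average (α : Closed Λ) :
    deRhamClass Λ ⟨constForm Λ (average (α : Form Λ 2)), constForm_mem_closed Λ _⟩ =
      deRhamClass Λ α :=
  (Submodule.Quotient.eq _).2 ⟨_, d_integralPrimitive _ α.2⟩

end Average

/-! ### Alternating forms of type `(1,1)` on `ℂ²` -/

section Linear

/-- An alternating real form on `ℂ²` is of type `(1,1)` if it is invariant under the complex
structure. -/
def IsType11 (w : C2 [⋀^Fin 2]→L[ℝ] ℝ) : Prop :=
  ∀ u v : C2, w ![Complex.I • u, Complex.I • v] = w ![u, v]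

/-- Positivity of an alternating real form `w`: the bilinear form `w(u, iv)` is
positive definite. -/
def IsPositive (w : C2 [⋀^Fin 2]→L[ℝ] ℝ) : Prop := ∀ v : C2, v ≠ 0 → 0 < w ![v, Complex.I • v]

variable (w : C2 [⋀^Fin 2]→L[ℝ] ℝ)

theorem alternating_add_left (u u' v : C2) : w ![u + u', v] = w ![u, v] + w ![u', v] := by
  simp only [← ContinuousAlternatingMap.curryLeft_apply_apply, map_add]
  rfl

theorem alternating_smul_left (c : ℝ) (u v : C2) : w ![c • u, v] = c * w ![u, v] := by
  simp only [← ContinuousAlternatingMap.curryLeft_apply_apply, map_smul]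
  rfl

theorem alternating_self (u : C2) : w ![u, u] = 0 :=
  w.map_eq_zero_of_eq ![u, u] (i := 0) (j := 1) rfl (by decide)

theorem alternating_swap (u v : C2) : w ![v, u] = -w ![u, v] := by
  have h : ![v, u] = ![u, v] ∘ Equiv.swap 0 1 := by ext i; fin_cases i <;> simp
  rw [h]
  exact w.toAlternatingMap.map_swap ![u, v] (by decide)

theorem alternating_add_right (u v v' : C2) : w ![u, v + v'] = w ![u, v] + w ![u, v'] := by
  rw [alternating_swap w (v + v'), alternating_add_left, alternating_swap w v,
    alternating_swap w v']
  ring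

theorem alternating_smul_right (c : ℝ) (u v : C2) : w ![u, c • v] = c * w ![u, v] := by
  rw [alternating_swap w (c • v), alternating_smul_left, alternating_swap w v]
  ring

theorem alternating_neg_left (u v : C2) : w ![-u, v] = -w ![u, v] := by
  simpa using alternating_smul_left w (-1) u v

variable {w}

theorem IsType11.apply_smul_left (hw : IsType11 w) (u v : C2) :
    w ![Complex.I • u, v] = -w ![u, Complex.I • v] := by
  rw [← hw (Complex.I • u) v, smul_smul, Complex.I_mul_I, neg_one_smul, alternating_neg_left]

/-- A `(1,1)`-form is a Hermitian matrix, whose determinant is half of `w ∧ w`. -/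
theorem IsType11.wedge_self_frame (hw : IsType11 w) :
    wedge w w frame = 2 * (w ![frame 0, Complex.I • frame 0] * w ![frame 2, Complex.I • frame 2]
      - w ![frame 0, frame 2] ^ 2 - w ![frame 0, Complex.I • frame 2] ^ 2) := by
  have h1 : frame 1 = Complex.I • frame 0 := by ext i; fin_cases i <;> simp [frame]
  have h3 : frame 3 = Complex.I • frame 2 := by ext i; fin_cases i <;> simp [frame]
  rw [wedge, h1, h3, hw, hw.apply_smul_left]
  ring

theorem smul_frame_add (a b c e : ℝ) :
    a • frame 0 + b • Complex.I • frame 0 + c • frame 2 + e • Complex.I • frame 2 =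
      ![⟨a, b⟩, ⟨c, e⟩] := by
  ext i
  fin_cases i <;> apply Complex.ext <;> simp [frame]

/-- The quadratic form of the Hermitian matrix of a `(1,1)`-form. -/
theorem IsType11.apply_smul_I (hw : IsType11 w) (a b c e : ℝ) :
    w ![![⟨a, b⟩, ⟨c, e⟩], Complex.I • ![⟨a, b⟩, ⟨c, e⟩]] =
      w ![frame 0, Complex.I • frame 0] * (a ^ 2 + b ^ 2)
      + w ![frame 2, Complex.I • frame 2] * (c ^ 2 + e ^ 2)
      + 2 * (w ![frame 0, Complex.I • frame 2] * (a * c + b * e)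
        + w ![frame 0, frame 2] * (b * c - a * e)) := by
  have h : Complex.I • (![⟨a, b⟩, ⟨c, e⟩] : C2) = ![⟨-b, a⟩, ⟨-e, c⟩] := by
    ext i
    fin_cases i <;> apply Complex.ext <;> simp
  rw [h, ← smul_frame_add, ← smul_frame_add]
  have h2 : w ![frame 2, Complex.I • frame 0] = w ![frame 0, Complex.I • frame 2] := by
    rw [← neg_neg (w ![frame 2, _]), ← hw.apply_smul_left, alternating_swap w (frame 0), neg_neg]
  simp only [alternating_add_left, alternating_add_right, alternating_smul_left,
    alternating_smul_right, hw _ _]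
  simp only [hw.apply_smul_left, alternating_self, alternating_swap w (frame 0) (frame 2), h2]
  ring

/-- Sylvester's criterion for the Hermitian matrix of a `(1,1)`-form, with the first diagonal entry
replaced by the trace. -/
theorem IsType11.isPositive (hw : IsType11 w) (hdet : 0 < wedge w w frame)
    (htr : 0 < w ![frame 0, Complex.I • frame 0] + w ![frame 2, Complex.I • frame 2]) :
    IsPositive w := by
  intro v hv
  obtain ⟨a, b, c, e, rfl⟩ : ∃ a b c e : ℝ, v = ![⟨a, b⟩, ⟨c, e⟩] :=
    ⟨(v 0).re, (v 0).im, (v 1).re, (v 1).im, by ext i; fin_cases i <;> rfl⟩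
  rw [hw.apply_smul_I]
  rw [hw.wedge_self_frame] at hdet
  generalize w ![frame 0, Complex.I • frame 0] = p at *
  generalize w ![frame 2, Complex.I • frame 2] = q at *
  generalize w ![frame 0, frame 2] = r at *
  generalize w ![frame 0, Complex.I • frame 2] = s at *
  have hpq : 0 < p * q := by nlinarith [sq_nonneg r, sq_nonneg s]
  -- The diagonal entries have the same sign, and their sum is positive.
  have hp : 0 < p := by
    by_contra! hp
    nlinarith
  have hD : 0 < p * q - r ^ 2 - s ^ 2 := by linarith
  refine pos_of_mul_pos_right (a := p) ?_ hp.le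
  -- Completing the square in the first complex variable.
  have key : p * (p * (a ^ 2 + b ^ 2) + q * (c ^ 2 + e ^ 2)
      + 2 * (s * (a * c + b * e) + r * (b * c - a * e))) =
      (p * a + s * c - r * e) ^ 2 + (p * b + s * e + r * c) ^ 2
        + (p * q - r ^ 2 - s ^ 2) * (c ^ 2 + e ^ 2) := by ring
  rw [key]
  rcases eq_or_ne (c ^ 2 + e ^ 2) 0 with h0 | h0
  · obtain ⟨rfl, rfl⟩ : c = 0 ∧ e = 0 := ⟨by nlinarith, by nlinarith⟩
    have hab : a ≠ 0 ∨ b ≠ 0 := by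
      by_contra! hab
      obtain ⟨rfl, rfl⟩ := hab
      exact hv (by ext i; fin_cases i <;> rfl)
    rcases hab with h | h <;> simp only [mul_zero, add_zero, sub_zero] <;> positivity
  · positivity

theorem IsPositive.apply_frame_zero (hw : IsPositive w) :
    0 < w ![frame 0, Complex.I • frame 0] :=
  hw _ fun h => by simpa [frame] using congrFun h 0

theorem IsPositive.apply_frame_two (hw : IsPositive w) :
    0 < w ![frame 2, Complex.I • frame 2] :=
  hw _ fun h => by simpa [frame] using congrFun h 1

theorem IsPositive.wedge_self_frame_pos (hpos : IsPositive w) (hw : IsType11 w) :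
    0 < wedge w w frame := by
  have hp := hpos.apply_frame_zero
  rw [hw.wedge_self_frame]
  -- On a vector orthogonal to `frame 0`, the quadratic form is a diagonal entry times the
  -- determinant.
  have h := hw.apply_smul_I (-w ![frame 0, Complex.I • frame 2]) (-w ![frame 0, frame 2])
    (w ![frame 0, Complex.I • frame 0]) 0
  have h2 := hpos ![⟨-w ![frame 0, Complex.I • frame 2], -w ![frame 0, frame 2]⟩,
    ⟨w ![frame 0, Complex.I • frame 0], 0⟩] fun h => by
      have := congrArg Complex.re (congrFun h 1)
      simp at this
      exact hp.ne' this
  rw [h] at h2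
  generalize w ![frame 0, Complex.I • frame 0] = p at *
  generalize w ![frame 2, Complex.I • frame 2] = q at *
  generalize w ![frame 0, frame 2] = r at *
  generalize w ![frame 0, Complex.I • frame 2] = s at *
  refine pos_of_mul_pos_right (a := p) ?_ hp.le
  linarith

theorem IsPositive.combo {w' : C2 [⋀^Fin 2]→L[ℝ] ℝ} (hw : IsPositive w) (hw' : IsPositive w')
    {a b : ℝ} (ha : 0 ≤ a) (hb : 0 ≤ b) (hab : a + b = 1) : IsPositive (a • w + b • w') :=
  fun v hv => convex_Ioi (0 : ℝ) (hw v hv) (hw' v hv) ha hb hab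

/-- The standard Kähler form `(i/2) ∑ dzₖ ∧ dz̄ₖ` on `ℂ²`. -/
def stdForm : C2 [⋀^Fin 2]→L[ℝ] ℝ where
  toFun m := ∑ k, ((m 0 k).re * (m 1 k).im - (m 0 k).im * (m 1 k).re)
  map_update_add' m i x y := by
    fin_cases i <;> simp [Function.update] <;> ring
  map_update_smul' m i c x := by
    fin_cases i <;> simp [Function.update] <;> ring
  cont := by fun_prop
  map_eq_zero_of_eq' m i j h hij := by
    have h01 : m 0 = m 1 := by fin_cases i <;> fin_cases j <;> simp_all
    simp only [h01]
    exact Finset.sum_eq_zero fun k _ => by ring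

theorem stdForm_apply (u v : C2) :
    stdForm ![u, v] = ∑ k, ((u k).re * (v k).im - (u k).im * (v k).re) := rfl

theorem isType11_stdForm : IsType11 stdForm := by
  intro u v
  simp only [stdForm_apply, Fin.sum_univ_two]
  simp
  ring

theorem isPositive_stdForm : IsPositive stdForm := by
  intro v hv
  obtain ⟨k, hk⟩ := Function.ne_iff.1 hv
  have h : stdForm ![v, Complex.I • v] = ∑ k, Complex.normSq (v k) := by
    simp [stdForm_apply, Complex.normSq_apply]
  rw [h]
  exact Finset.sum_pos' (fun k _ => Complex.normSq_nonneg _)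
    ⟨k, Finset.mem_univ k, Complex.normSq_pos.2 hk⟩

/-- Exterior multiplication with the standard Kähler form is the trace of the Hermitian matrix. -/
theorem wedge_stdForm_frame (w : C2 [⋀^Fin 2]→L[ℝ] ℝ) : wedge w stdForm frame =
    w ![frame 0, Complex.I • frame 0] + w ![frame 2, Complex.I • frame 2] := by
  have h1 : frame 1 = Complex.I • frame 0 := by ext i; fin_cases i <;> simp [frame]
  have h3 : frame 3 = Complex.I • frame 2 := by ext i; fin_cases i <;> simp [frame]
  rw [wedge, ← h1, ← h3]
  simp [stdForm_apply, frame]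

theorem IsType11.wedge_stdForm_frame_ne_zero (hw : IsType11 w) (hdet : 0 < wedge w w frame) :
    wedge w stdForm frame ≠ 0 := by
  rw [wedge_stdForm_frame]
  rw [hw.wedge_self_frame] at hdet
  intro h
  rw [eq_neg_of_add_eq_zero_left h] at hdet
  nlinarith [sq_nonneg (w ![frame 0, frame 2]), sq_nonneg (w ![frame 0, Complex.I • frame 2]),
    sq_nonneg (w ![frame 2, Complex.I • frame 2])]

end Linear

/-! ### Classes of translation-invariant forms -/

section Classes

variable (Λ : Submodule ℤ C2)

/-- The cohomology class of the translation-invariant form with the given value. -/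
def constClass : (C2 [⋀^Fin 2]→L[ℝ] ℝ) →ₗ[ℝ] H2 Λ where
  toFun w := deRhamClass Λ ⟨constForm Λ w, constForm_mem_closed Λ w⟩
  map_add' w w' := map_add (deRhamClass Λ) ⟨constForm Λ w, constForm_mem_closed Λ w⟩
    ⟨constForm Λ w', constForm_mem_closed Λ w'⟩
  map_smul' c w := map_smul (deRhamClass Λ) c ⟨constForm Λ w, constForm_mem_closed Λ w⟩

variable {Λ}

theorem mem_kahlerCone_of_constClass {x : H11 Λ} {w : C2 [⋀^Fin 2]→L[ℝ] ℝ} (hw : IsType11 w)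
    (hpos : IsPositive w) (hx : constClass Λ w = x) : x ∈ kahlerCone Λ :=
  ⟨⟨constForm Λ w, constForm_mem_closed Λ w⟩,
    ⟨constForm_mem_closed Λ w, fun _ => hw, fun _ => hpos⟩, hx⟩

theorem constClass_mem_H11 {w : C2 [⋀^Fin 2]→L[ℝ] ℝ} (hw : IsType11 w) :
    constClass Λ w ∈ H11 Λ :=
  ⟨⟨constForm Λ w, constForm_mem_closed Λ w⟩, fun _ => hw, rfl⟩

theorem kahlerCone_nonempty : (kahlerCone Λ).Nonempty :=
  ⟨⟨constClass Λ stdForm, constClass_mem_H11 isType11_stdForm⟩,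
    mem_kahlerCone_of_constClass isType11_stdForm isPositive_stdForm rfl⟩

variable [DiscreteTopology Λ] [IsZLattice ℝ Λ]

theorem isType11_average {α : Form Λ 2} (hα : α ∈ Form11 Λ) : IsType11 (average α) := by
  intro u v
  rw [average_apply, average_apply]
  congr 2
  exact funext fun x => hα (proj Λ x) u v

theorem isPositive_average {α : Form Λ 2} (hα : IsKahlerForm α) : IsPositive (average α) := by
  intro v hv
  have h : ∀ x, 0 < pullback α x ![v, Complex.I • v] := fun x => hα.2.2 (proj Λ x) v hv
  rw [average_apply]
  refine mul_pos (inv_pos.2 (volume_real_fundDom_pos Λ)) ?_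
  rw [setIntegral_pos_iff_support_of_nonneg_ae (Filter.Eventually.of_forall fun x => (h x).le)
    (integrableOn_fundDom Λ (continuous_pullback_apply α _).continuous)]
  rw [Function.support_eq_univ (fun x => (h x).ne'), Set.univ_inter]
  exact (ENNReal.toReal_pos_iff.1 (volume_real_fundDom_pos Λ)).1

theorem exists_constClass_eq (x : H11 Λ) : ∃ w, IsType11 w ∧ constClass Λ w = x := by
  obtain ⟨_, α, hα, rfl⟩ := x
  exact ⟨average (α : Form Λ 2), isType11_average hα, deRhamClass_constForm_average α⟩

theorem mem_kahlerCone_iff {x : H11 Λ} :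
    x ∈ kahlerCone Λ ↔ ∃ w, IsType11 w ∧ IsPositive w ∧ constClass Λ w = x := by
  refine ⟨fun ⟨α, hα, hx⟩ => ?_, fun ⟨w, hw, hpos, hx⟩ => mem_kahlerCone_of_constClass hw hpos hx⟩
  exact ⟨average (α : Form Λ 2), isType11_average hα.2.1, isPositive_average hα,
    (deRhamClass_constForm_average α).trans hx⟩

theorem intersectionForm_constClass (w w' : C2 [⋀^Fin 2]→L[ℝ] ℝ) :
    intersectionForm Λ (constClass Λ w) (constClass Λ w') =
      volume.real (fundDom Λ) * wedge w w' frame := by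
  refine (intersectionForm_deRhamClass Λ _ _).trans ?_
  simp only [pullback_constForm, integral_const, measureReal_restrict_apply_univ, smul_eq_mul]

theorem convex_kahlerCone : Convex ℝ (kahlerCone Λ) := by
  intro x hx y hy a b ha hb hab
  obtain ⟨w, hw, hpos, hx⟩ := mem_kahlerCone_iff.1 hx
  obtain ⟨w', hw', hpos', hy⟩ := mem_kahlerCone_iff.1 hy
  refine mem_kahlerCone_of_constClass (w := a • w + b • w') (fun u v => ?_)
    (hpos.combo hpos' ha hb hab) ?_
  · exact congrArg₂ (a * · + b * ·) (hw u v) (hw' u v)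
  · rw [map_add, map_smul, map_smul, hx, hy]
    rfl

theorem isPreconnected_kahlerCone : IsPreconnected (kahlerCone Λ) := by
  have : IsModuleTopology ℝ (H11 Λ) := ⟨rfl⟩
  have : IsTopologicalAddGroup (H11 Λ) := IsModuleTopology.topologicalAddGroup ℝ (H11 Λ)
  exact convex_kahlerCone.isPreconnected

theorem kahlerCone_subset_positiveSet : kahlerCone Λ ⊆ positiveSet Λ := by
  intro x hx
  obtain ⟨w, hw, hpos, hx⟩ := mem_kahlerCone_iff.1 hx
  change 0 < intersectionForm Λ x x
  rw [← hx, intersectionForm_constClass]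
  exact mul_pos (volume_real_fundDom_pos Λ) (hpos.wedge_self_frame_pos hw)

variable (Λ) in
/-- The degree of a class with respect to the standard Kähler class. -/
def degree : H11 Λ →ₗ[ℝ] ℝ :=
  ((intersectionForm Λ).flip (constClass Λ stdForm)).comp (H11 Λ).subtype

theorem degree_eq {x : H11 Λ} {w : C2 [⋀^Fin 2]→L[ℝ] ℝ} (hx : constClass Λ w = x) :
    degree Λ x = volume.real (fundDom Λ) * wedge w stdForm frame := by
  rw [← intersectionForm_constClass, hx]
  rfl

theorem continuous_degree : Continuous (degree Λ) := by
  have : IsModuleTopology ℝ (H11 Λ) := ⟨rfl⟩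
  exact IsModuleTopology.continuous_of_linearMap (degree Λ)

theorem degree_pos {x : H11 Λ} (hx : x ∈ kahlerCone Λ) : 0 < degree Λ x := by
  obtain ⟨w, hw, hpos, hx⟩ := mem_kahlerCone_iff.1 hx
  rw [degree_eq hx, wedge_stdForm_frame]
  exact mul_pos (volume_real_fundDom_pos Λ) (add_pos hpos.apply_frame_zero hpos.apply_frame_two)

theorem wedge_self_frame_pos_of_mem_positiveSet {x : H11 Λ} (hx : x ∈ positiveSet Λ)
    {w : C2 [⋀^Fin 2]→L[ℝ] ℝ} (hw : constClass Λ w = x) : 0 < wedge w w frame := by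
  change 0 < intersectionForm Λ x x at hx
  rw [← hw, intersectionForm_constClass] at hx
  exact pos_of_mul_pos_right hx (volume_real_fundDom_pos Λ).le

/-- The Hodge index inequality: a class of positive square is not orthogonal to the standard Kähler
class. -/
theorem degree_ne_zero {x : H11 Λ} (hx : x ∈ positiveSet Λ) : degree Λ x ≠ 0 := by
  obtain ⟨w, hw, hwx⟩ := exists_constClass_eq x
  rw [degree_eq hwx]
  exact mul_ne_zero (volume_real_fundDom_pos Λ).ne'
    (hw.wedge_stdForm_frame_ne_zero (wedge_self_frame_pos_of_mem_positiveSet hx hwx))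

theorem mem_kahlerCone_of_degree_pos {x : H11 Λ} (hx : x ∈ positiveSet Λ) (hd : 0 < degree Λ x) :
    x ∈ kahlerCone Λ := by
  obtain ⟨w, hw, hwx⟩ := exists_constClass_eq x
  rw [degree_eq hwx, wedge_stdForm_frame] at hd
  exact mem_kahlerCone_of_constClass hw (hw.isPositive
    (wedge_self_frame_pos_of_mem_positiveSet hx hwx)
    (pos_of_mul_pos_right hd (volume_real_fundDom_pos Λ).le)) hwx

theorem degree_pos_of_mem_connectedComponentIn {κ x : H11 Λ} (hκ : κ ∈ kahlerCone Λ)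
    (hx : x ∈ connectedComponentIn (positiveSet Λ) κ) : 0 < degree Λ x := by
  by_contra! hneg
  obtain ⟨y, hy, hy0⟩ := isPreconnected_connectedComponentIn.intermediate_value hx
    (mem_connectedComponentIn (kahlerCone_subset_positiveSet hκ)) continuous_degree.continuousOn
    ⟨hneg, (degree_pos hκ).le⟩
  exact degree_ne_zero (connectedComponentIn_subset _ _ hy) hy0

end Classes

end ComplexTorus

end

theorem mainTheorem6 (Λ : Submodule ℤ ComplexTorus.C2) [DiscreteTopology Λ] [IsZLattice ℝ Λ] :
    (ComplexTorus.kahlerCone Λ).Nonempty ∧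
      ∀ κ ∈ ComplexTorus.kahlerCone Λ,
        κ ∈ ComplexTorus.positiveSet Λ ∧
          ComplexTorus.kahlerCone Λ =
            connectedComponentIn (ComplexTorus.positiveSet Λ) κ := by
  refine ⟨ComplexTorus.kahlerCone_nonempty, fun κ hκ =>
    ⟨ComplexTorus.kahlerCone_subset_positiveSet hκ, Set.Subset.antisymm ?_ fun x hx => ?_⟩⟩
  · exact ComplexTorus.isPreconnected_kahlerCone.subset_connectedComponentIn hκ
      ComplexTorus.kahlerCone_subset_positiveSet
  · exact ComplexTorus.mem_kahlerCone_of_degree_pos (connectedComponentIn_subset _ _ hx)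
      (ComplexTorus.degree_pos_of_mem_connectedComponentIn hκ hx)
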